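/- Let $\mathbb N=\{1,2,3,\dots\}$ and let $\mathcal M'$ be the set of completely multiplicative functions $f:\mathbb N\to\{+1,-1\}$. A function $f\in\mathcal M'$ is a *length-$k$ function* if $k$ is the largest positive integer for which there is an integer $n\ge 0$ with $f(n+1)=\cdots=f(n+k)=+1$. For functions $f,g:\mathbb N\to\mathbb C$ bounded by $1$ in absolute value and $x\ge 1$ put $$\mathbb D(f,g;x)=\Bigl(\sum_{p\le x}\frac{1-\operatorname{Re}\bigl(f(p)\overline{g(p)}\bigr)}{p}\Bigr)^{1/2},$$ where $p$ runs over primes. We say that $f$ is *pretentious to* $g$ if $\mathbb D(f,g;x)=O(1)$ as $x\to\infty$, and that $f$ is *non-pretentious* if there are no Dirichlet character $\chi$ (of any modulus $q\ge1$) and real number $t$ such that $f$ is pretentious to $n\mapsto\chi(n)n^{it}$. *Elliott's conjecture* (for $\mathcal M'$) is the following statement: for all positive integers $N,a_1,\dots,a_N,b_1,\dots,b_N$ with $a_ib_j\ne a_jb_i$ whenever $i\ne j$, and every non-pretentious $f\in\mathcal M'$, $$\sum_{n\le x}\ \prod_{i=1}^N f(a_in+b_i)=o(x)\qquad(x\to\infty).$$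 **Corollary 1.4.** Let $k\in\mathbb N$ and let $f\in\mathcal M'$ be a length-$k$ function. (a) Assume Elliott's conjecture. Then there are an integer $q>1$ and a real-valued Dirichlet character $\chi_q$ mod $q$, which is primitive or principal, such that $f$ is pretentious to $\chi_q$. (b) (Unconditionally.) Let $q>1$ and let $\chi_q$ be a real-valued Dirichlet character mod $q$ such that $f$ is pretentious to $\chi_q$. Then the set $$\mathcal J(k)=\{p \text{ prime}: p>k,\ p\nmid q,\ f(p)\ne\chi_q(p)\}$$ is finite and $|\mathcal J(k)|\le \tfrac12 k$. -/

import Mathlib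

open Filter Asymptotics

/-- `f` is a completely multiplicative function from the positive integers to `{+1, -1}`.
The value `f 0` carries no information and is never used below. -/
structure IsSignCompletelyMultiplicative (f : ℕ → ℤ) : Prop where
  sign : ∀ n : ℕ, 0 < n → f n = 1 ∨ f n = -1
  mul : ∀ a b : ℕ, 0 < a → 0 < b → f (a * b) = f a * f b

/-- `k` is the largest positive integer such that `f (n + 1) = ⋯ = f (n + k) = 1` for some
`n ≥ 0`. -/
def IsLengthFunction (k : ℕ) (f : ℕ → ℤ) : Prop :=
  IsGreatest {m : ℕ | 0 < m ∧ ∃ n : ℕ, ∀ j ∈ Finset.Icc 1 m, f (n + j) = 1} k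

/-- The pretentious distance `𝔻(f, g; x) = (∑_{p ≤ x} (1 - Re (f(p) conj g(p))) / p)^{1/2}`,
the sum being over primes. -/
noncomputable def pretentiousDist (f g : ℕ → ℂ) (x : ℝ) : ℝ :=
  Real.sqrt (∑ p ∈ (Finset.Icc 1 ⌊x⌋₊).filter Nat.Prime,
    (1 - (f p * (starRingEnd ℂ) (g p)).re) / (p : ℝ))

/-- `f` is pretentious to `g`: `𝔻(f, g; x) = O(1)` as `x → ∞`. -/
def PretentiousTo (f g : ℕ → ℂ) : Prop :=
  (fun x : ℝ => pretentiousDist f g x) =O[atTop] (fun _ : ℝ => (1 : ℝ))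

/-- `f` is pretentious to some twisted character `n ↦ χ(n) n^{it}`, with `χ` a Dirichlet
character of some modulus `q ≥ 1` and `t` real. -/
def IsPretentious (f : ℕ → ℂ) : Prop :=
  ∃ q : ℕ, 0 < q ∧ ∃ (χ : DirichletCharacter ℂ q) (t : ℝ),
    PretentiousTo f (fun n : ℕ => χ (n : ZMod q) * (n : ℂ) ^ (Complex.I * (t : ℂ)))

/-- Elliott's conjecture for completely multiplicative functions with values `±1`. -/
def ElliottConjecture : Prop :=
  ∀ (N : ℕ) (a b : Fin N → ℕ), 0 < N → (∀ i, 0 < a i) → (∀ i, 0 < b i) →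
    (∀ i j, i ≠ j → a i * b j ≠ a j * b i) →
    ∀ f : ℕ → ℤ, IsSignCompletelyMultiplicative f → ¬ IsPretentious (fun n => (f n : ℂ)) →
      (fun x : ℝ => ∑ n ∈ Finset.Icc 1 ⌊x⌋₊, ∏ i, (f (a i * n + b i) : ℝ))
        =o[atTop] (fun x : ℝ => x)

/-- A Dirichlet character all of whose values are real. -/
def IsRealCharacter {q : ℕ} (χ : DirichletCharacter ℂ q) : Prop :=
  ∀ a : ZMod q, (χ a).im = 0

/-- The set of primes `p > k` not dividing `q` with `f(p) ≠ χ(p)`. -/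
def exceptionalPrimes (k : ℕ) (f : ℕ → ℤ) {q : ℕ} (χ : DirichletCharacter ℂ q) : Set ℕ :=
  {p : ℕ | p.Prime ∧ k < p ∧ ¬ p ∣ q ∧ (f p : ℂ) ≠ χ (p : ZMod q)}

/-! For (b), suppose some set `P` of exceptional primes has `2 * P.card ≥ K`, where `K = k + 1`; the
aim is a run of `K` values `+1`, which is impossible. Let `g` be the sign function equal to `f` at
primes dividing a suitable `D` and to the character elsewhere, in particular at the primes of `P`.
Some window of length `K` has nonnegative `g`-sum (`exists_window_sum_nonneg`), so at most `P.card`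
of its values are `-1`. Give each such place its own prime of `P`. By the Chinese remainder theorem,
`n` can imitate the start `n₀` of that window modulo a high power of `D`, while each assigned prime
divides exactly its own place, exactly once. Since `f` and the character differ in sign at that
prime, this repairs the bad value. Pretentiousness makes the reciprocal sum over disagreement primes
converge, so a sieve (`exists_modEq_sieved`) finds such an `n` with no further disagreement prime in
the window. This is `exists_run_of_card_exceptional`.

For (a), Elliott's conjecture gives a non-pretentious `f` arbitrarily long runs, so a length-`k`
function is pretentious to some `χ(n) n^{it}`. As `f(p)² = 1`, the square of that twist is
pretentious to `1`; comparing Euler products near `s = 1` with the pole of zeta forces `χ² = 1` and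
`t = 0`. -/

/-! ### Windows with nonnegative sum -/

/-- Abel summation: partial sums bounded above by `C`, tested against nonincreasing nonnegative
weights. -/
theorem sum_mul_le_of_partial_sums_le {h w : ℕ → ℤ} {C : ℤ} (hw : Antitone w) (hw0 : ∀ i, 0 ≤ w i)
    (hC : ∀ N, ∑ i ∈ Finset.range N, h i ≤ C) (N : ℕ) :
    ∑ i ∈ Finset.range N, h i * w i ≤ C * w 0 := by
  have key : ∑ i ∈ Finset.range N, h i * w i
      ≤ C * (w 0 - w N) + (∑ i ∈ Finset.range N, h i) * w N := by
    induction N with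
    | zero => simp
    | succ N ih =>
      have h1 := hC (N + 1)
      have h2 := hw (Nat.le_succ N)
      rw [Finset.sum_range_succ] at h1 ⊢
      rw [Finset.sum_range_succ]
      have h3 := mul_le_mul_of_nonneg_right h1 (sub_nonneg.2 h2)
      simp only [Nat.succ_eq_add_one] at h3
      linarith
  have h4 := mul_le_mul_of_nonneg_right (hC N) (hw0 N)
  linarith

theorem IsSignCompletelyMultiplicative.map_one {g : ℕ → ℤ} (hg : IsSignCompletelyMultiplicative g) :
    g 1 = 1 := by
  have h := hg.mul 1 1 one_pos one_pos
  rcases hg.sign 1 one_pos with h1 | h1 <;> simp [h1] at h ⊢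

theorem IsSignCompletelyMultiplicative.map_pow {g : ℕ → ℤ} (hg : IsSignCompletelyMultiplicative g)
    {a : ℕ} (ha : 0 < a) (n : ℕ) : g (a ^ n) = g a ^ n := by
  induction n with
  | zero => simpa using hg.map_one
  | succ n ih => rw [pow_succ, hg.mul _ _ (pow_pos ha n) ha, ih, pow_succ]

/-- The extension by `0` at `0`, as an arithmetic function. -/
def positiveArithmeticFunction (g : ℕ → ℤ) : ArithmeticFunction ℤ :=
  ⟨fun n => if n = 0 then 0 else g n, by simp⟩

theorem positiveArithmeticFunction_apply (g : ℕ → ℤ) {n : ℕ} (hn : n ≠ 0) :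
    positiveArithmeticFunction g n = g n := by
  simp [positiveArithmeticFunction, hn]

/-- By multiplicativity only prime powers matter, and there the divisor sum is the geometric sum of
`g p = ±1`, which is `k + 1`, `1` or `0`. -/
theorem IsSignCompletelyMultiplicative.mul_zeta_nonneg {g : ℕ → ℤ}
    (hg : IsSignCompletelyMultiplicative g) (n : ℕ) :
    0 ≤ (positiveArithmeticFunction g * ((ArithmeticFunction.zeta : ArithmeticFunction ℕ) :
      ArithmeticFunction ℤ)) n := by
  have hm : (positiveArithmeticFunction g).IsMultiplicative := by
    rw [ArithmeticFunction.IsMultiplicative.iff_ne_zero]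
    refine ⟨by rw [positiveArithmeticFunction_apply g one_ne_zero, hg.map_one], ?_⟩
    intro m n hm hn _
    rw [positiveArithmeticFunction_apply g hm, positiveArithmeticFunction_apply g hn,
      positiveArithmeticFunction_apply g (mul_ne_zero hm hn),
      hg.mul m n (Nat.pos_of_ne_zero hm) (Nat.pos_of_ne_zero hn)]
  have hmz := hm.mul ArithmeticFunction.isMultiplicative_zeta.natCast (R := ℤ)
  induction n using Nat.recOnPosPrimePosCoprime with
  | zero => simp
  | one => rw [hmz.map_one]; exact zero_le_one
  | prime_pow p k hp hk =>
    rw [ArithmeticFunction.coe_mul_zeta_apply, Nat.sum_divisors_prime_pow hp]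
    have : ∀ i ∈ Finset.range (k + 1), positiveArithmeticFunction g (p ^ i) = g p ^ i := by
      intro i _
      rw [positiveArithmeticFunction_apply g (pow_ne_zero _ hp.ne_zero), hg.map_pow hp.pos]
    rw [Finset.sum_congr rfl this]
    rcases hg.sign p hp.pos with h | h
    · rw [h]; positivity
    · rw [h, neg_one_geom_sum]; split_ifs <;> norm_num
  | coprime a b ha hb hab iha ihb =>
    rw [hmz.map_mul_of_coprime hab]
    exact mul_nonneg iha ihb

/-- Interchanging summations turns this into the sum of the nonnegative divisor sums of `g` over `n
≤ N`. -/
theorem IsSignCompletelyMultiplicative.sum_mul_div_nonneg {g : ℕ → ℤ}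
    (hg : IsSignCompletelyMultiplicative g) (N : ℕ) :
    0 ≤ ∑ i ∈ Finset.range N, g (i + 1) * ((N / (i + 1) : ℕ) : ℤ) := by
  have h := ArithmeticFunction.sum_Ioc_mul_zeta_eq_sum (positiveArithmeticFunction g) N
  have h2 : ∑ n ∈ Finset.Ioc 0 N, positiveArithmeticFunction g n * ((N / n : ℕ) : ℤ)
      = ∑ i ∈ Finset.range N, g (i + 1) * ((N / (i + 1) : ℕ) : ℤ) := by
    rw [← Finset.Ico_add_one_add_one_eq_Ioc, Finset.sum_Ico_eq_sum_range]
    refine Finset.sum_congr (by simp) fun i _ => ?_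
    rw [positiveArithmeticFunction_apply g (by omega)]
    simp [add_comm]
  rw [← h2, ← h]
  exact Finset.sum_nonneg fun n _ => hg.mul_zeta_nonneg n

/-- A completely multiplicative sign function has, for every length, a window with nonnegative
sum. -/
theorem IsSignCompletelyMultiplicative.exists_window_sum_nonneg {g : ℕ → ℤ}
    (hg : IsSignCompletelyMultiplicative g) (K : ℕ) :
    ∃ n : ℕ, 0 ≤ ∑ j ∈ Finset.range K, g (n + j + 1) := by
  by_contra! hneg
  have hle : ∀ n, g (n + 1) ≤ 1 := fun n => by
    rcases hg.sign (n + 1) n.succ_pos with h | h <;> simp [h]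
  -- Window sums are integers, hence at most `-1`, so each full block of `K` terms contributes at
  -- most `0`; only an incomplete block of fewer than `K` terms can be positive.
  have hH : ∀ N, ∑ i ∈ Finset.range N, ((K : ℤ) * g (i + 1) + 1) ≤ (K : ℤ) * (K + 1) := by
    intro N
    induction N using Nat.strong_induction_on with
    | _ N ih =>
      rcases lt_or_ge N K with hN | hN
      · calc ∑ i ∈ Finset.range N, ((K : ℤ) * g (i + 1) + 1)
            ≤ ∑ i ∈ Finset.range N, ((K : ℤ) + 1) := by
              refine Finset.sum_le_sum fun i _ => ?_
              have := mul_le_mul_of_nonneg_left (hle i) (Int.natCast_nonneg K)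
              linarith
          _ = (N : ℤ) * (K + 1) := by simp
          _ ≤ _ := by gcongr
      · rcases Nat.eq_zero_or_pos K with rfl | hK
        · simpa using hneg 0
        obtain ⟨m, rfl⟩ := Nat.exists_eq_add_of_le' hN
        have h1 := ih m (by omega)
        rw [Finset.sum_range_add]
        have h2 : ∑ x ∈ Finset.range K, ((K : ℤ) * g (m + x + 1) + 1)
            = K * (∑ x ∈ Finset.range K, g (m + x + 1) + 1) := by
          rw [Finset.sum_add_distrib, ← Finset.mul_sum]
          simp; ring
        have h3 : (K : ℤ) * (∑ x ∈ Finset.range K, g (m + x + 1) + 1) ≤ 0 :=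
          mul_nonpos_of_nonneg_of_nonpos (by positivity) (by have := hneg m; omega)
        linarith
  -- Abel summation against `N / (i + 1)`; the part involving `g` is nonnegative and can be dropped.
  -- What remains contradicts the divergence of the harmonic series.
  have hsum : ∀ N : ℕ, ∑ i ∈ Finset.range N, ((N / (i + 1) : ℕ) : ℤ) ≤ (K : ℤ) * (K + 1) * N := by
    intro N
    have h1 := sum_mul_le_of_partial_sums_le (w := fun i => ((N / (i + 1) : ℕ) : ℤ))
      (fun a b hab => by
        simp only [Nat.cast_le]
        exact Nat.div_le_div_left (by omega) (by omega))
      (fun i => Int.natCast_nonneg _) hH N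
    simp only [zero_add, Nat.div_one, add_mul, one_mul, Finset.sum_add_distrib, mul_assoc,
      ← Finset.mul_sum] at h1
    have h2 := mul_nonneg (Int.natCast_nonneg K) (hg.sum_mul_div_nonneg N)
    linarith
  have hharm : ∀ N : ℕ, 0 < N →
      ∑ i ∈ Finset.range N, (1 / ((i : ℝ) + 1)) ≤ (K : ℝ) * (K + 1) + 1 := by
    intro N hN
    have hN' : (0 : ℝ) < N := by exact_mod_cast hN
    have h1 : ((∑ i ∈ Finset.range N, ((N / (i + 1) : ℕ) : ℤ) : ℤ) : ℝ) ≤ (K : ℝ) * (K + 1) * N := by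
      exact_mod_cast hsum N
    have h2 : (N : ℝ) * ∑ i ∈ Finset.range N, (1 / ((i : ℝ) + 1))
        ≤ ∑ i ∈ Finset.range N, ((((N / (i + 1) : ℕ) : ℤ) : ℝ) + 1) := by
      rw [Finset.mul_sum]
      refine Finset.sum_le_sum fun i _ => ?_
      have h3 := Nat.lt_floor_add_one ((N : ℝ) / ((i + 1 : ℕ) : ℝ))
      rw [Nat.floor_div_eq_div] at h3
      rw [mul_one_div]
      push_cast at h3 ⊢
      exact h3.le
    rw [Finset.sum_add_distrib] at h2
    push_cast at h1 h2
    simp only [Finset.sum_const, Finset.card_range, nsmul_eq_mul, mul_one] at h2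
    have h4 : (N : ℝ) * ∑ i ∈ Finset.range N, (1 / ((i : ℝ) + 1))
        ≤ N * ((K : ℝ) * (K + 1) + 1) := by linarith
    exact le_of_mul_le_mul_left h4 hN'
  obtain ⟨N, hN, hN1⟩ := ((Real.tendsto_sum_range_one_div_nat_succ_atTop.eventually_gt_atTop
    ((K : ℝ) * (K + 1) + 1)).and (eventually_gt_atTop 0)).exists
  exact absurd (hharm N hN1) (not_le.2 hN)

/-! ### Sieving by primes with convergent reciprocal sum -/

open Classical in
theorem exists_tail_sum_one_div_le {B : Set ℕ}
    (hB : Summable (B.indicator fun p : ℕ => 1 / (p : ℝ))) {ε : ℝ} (hε : 0 < ε) :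
    ∃ y : ℕ, ∀ F : Finset ℕ, (∀ p ∈ F, p ∈ B ∧ y < p) → ∑ p ∈ F, 1 / (p : ℝ) ≤ ε := by
  obtain ⟨s, hs⟩ := summable_iff_vanishing_norm.1 hB ε hε
  refine ⟨s.sup id, fun F hF => ?_⟩
  have hd : Disjoint F s := by
    rw [Finset.disjoint_left]
    intro p hp hps
    have := Finset.le_sup (f := id) hps
    have := (hF p hp).2
    simp only [id] at *
    omega
  have h := hs F hd
  rw [Finset.sum_congr rfl fun p hp => Set.indicator_of_mem (hF p hp).1 _] at h
  exact (le_abs_self _).trans h.le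

open Classical in
-- Beyond a cutoff `y`, each `p ≤ Z` satisfies `1 ≤ Z / p`, so the count up to `Z` is at most `y`
-- plus `Z` times a small tail. The sieve needs this to absorb the `+ 1` lost for each prime.
theorem eventually_card_le_of_summable_one_div {B : Set ℕ}
    (hB : Summable (B.indicator fun p : ℕ => 1 / (p : ℝ))) {ε : ℝ} (hε : 0 < ε) :
    ∀ᶠ Z : ℕ in atTop, (((Finset.Icc 1 Z).filter (· ∈ B)).card : ℝ) ≤ ε * Z := by
  obtain ⟨y, hy⟩ := exists_tail_sum_one_div_le hB (half_pos hε)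
  filter_upwards [eventually_ge_atTop ⌈(y : ℝ) / (ε / 2)⌉₊] with Z hZ
  have hZ' : (y : ℝ) ≤ ε / 2 * Z := by
    have := Nat.ceil_le.1 hZ
    rw [div_le_iff₀ (half_pos hε)] at this
    linarith
  have hsub : (Finset.Icc 1 Z).filter (· ∈ B) ⊆
      Finset.Icc 1 y ∪ (Finset.Icc 1 Z).filter (fun p => p ∈ B ∧ y < p) := by
    intro p hp
    simp only [Finset.mem_union, Finset.mem_filter, Finset.mem_Icc] at hp ⊢
    by_cases h : y < p
    · exact Or.inr ⟨hp.1, hp.2, h⟩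
    · exact Or.inl ⟨hp.1.1, by omega⟩
  have h1 := (Finset.card_le_card hsub).trans (Finset.card_union_le _ _)
  rw [Nat.card_Icc, Nat.add_sub_cancel] at h1
  have h2 : (((Finset.Icc 1 Z).filter (fun p => p ∈ B ∧ y < p)).card : ℝ) ≤ Z * (ε / 2) := by
    refine le_trans ?_ (mul_le_mul_of_nonneg_left
      (hy ((Finset.Icc 1 Z).filter (fun p => p ∈ B ∧ y < p)) ?_) (Nat.cast_nonneg Z))
    · rw [Finset.mul_sum, Finset.card_eq_sum_ones, Nat.cast_sum]
      refine Finset.sum_le_sum fun p hp => ?_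
      simp only [Finset.mem_filter, Finset.mem_Icc] at hp
      have hp0 : (0 : ℝ) < p := by exact_mod_cast hp.1.1
      rw [mul_one_div, Nat.cast_one, one_le_div hp0]
      exact_mod_cast hp.1.2
    · intro p hp
      exact (Finset.mem_filter.1 hp).2
  have h3 : (((Finset.Icc 1 Z).filter (· ∈ B)).card : ℝ)
      ≤ y + ((Finset.Icc 1 Z).filter (fun p => p ∈ B ∧ y < p)).card := by exact_mod_cast h1
  linarith

theorem card_filter_dvd_progression_le {p M : ℕ} (hp : 0 < p) (hpM : Nat.Coprime p M) (c X : ℕ) :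
    (((Finset.range X).filter (fun t => p ∣ c + M * t)).card : ℝ) ≤ X * (1 / (p : ℝ)) + 1 := by
  rcases ((Finset.range X).filter (fun t => p ∣ c + M * t)).eq_empty_or_nonempty with h | ⟨t₀, ht₀⟩
  · rw [h]; simp; positivity
  have h₀ := (Finset.mem_filter.1 ht₀).2
  have hsub : (Finset.range X).filter (fun t => p ∣ c + M * t) ⊆
      (Finset.range X).filter (fun t => t ≡ t₀ [MOD p]) := by
    intro t ht
    rw [Finset.mem_filter] at ht ⊢
    refine ⟨ht.1, ?_⟩
    have h1 : c + M * t ≡ c + M * t₀ [MOD p] :=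
      ((Nat.modEq_zero_iff_dvd).2 ht.2).trans ((Nat.modEq_zero_iff_dvd).2 h₀).symm
    exact Nat.ModEq.cancel_left_of_coprime hpM (Nat.ModEq.add_left_cancel' c h1)
  have h2 := Finset.card_le_card hsub
  rw [← Nat.count_eq_card_filter_range (fun t => t ≡ t₀ [MOD p]), Nat.count_modEq_card X hp] at h2
  have h3 : ((X / p : ℕ) : ℝ) ≤ X * (1 / (p : ℝ)) := by
    rw [mul_one_div]; exact Nat.cast_div_le
  have h4 : ((X / p + if t₀ % p < X % p then 1 else 0 : ℕ) : ℝ) ≤ X * (1 / (p : ℝ)) + 1 := by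
    push_cast
    split_ifs <;> linarith
  exact le_trans (by exact_mod_cast h2) h4

open Classical in
/-- Union-bound sieve: if the primes of `B` have convergent reciprocal sum, then every residue
class modulo `M` divisible by all small primes contains an `n` for which no prime of `B` coprime
to `M` divides any of `n + 1, …, n + K`. -/
theorem exists_modEq_sieved {B : Set ℕ} (hBp : ∀ p ∈ B, p.Prime)
    (hB : Summable (B.indicator fun p : ℕ => 1 / (p : ℝ))) (K : ℕ) :
    ∃ y : ℕ, ∀ M a : ℕ, 0 < M → (∀ p, p.Prime → p ≤ y → p ∣ M) →
      ∃ n, n ≡ a [MOD M] ∧ ∀ j ∈ Finset.range K, ∀ p ∈ B, p ∣ n + j + 1 → p ∣ M := by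
  have hK : (0 : ℝ) < 4 * (K + 1) := by positivity
  obtain ⟨y, hy⟩ := exists_tail_sum_one_div_le hB (one_div_pos.2 hK)
  refine ⟨y, fun M a hM hyM => ?_⟩
  have hMr : (0 : ℝ) < M := by exact_mod_cast hM
  obtain ⟨Z₀, hZ₀⟩ := eventually_atTop.1 (eventually_card_le_of_summable_one_div hB
    (ε := 1 / (4 * (K + 1) * M)) (by positivity))
  -- Candidates are `a + M * t` with `t < X`; `Z` bounds every window entry, and the size of `X`
  -- gives `Z₀ ≤ Z ≤ 2 * M * X`. The main terms then exclude at most `X / 4` values of `t` and the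
  -- `+ 1` terms at most `X / 2`.
  set X : ℕ := Z₀ + a + K + 1 with hX
  set Z : ℕ := a + K + M * X with hZ
  have hZZ : Z₀ ≤ Z := by
    have : X ≤ M * X := Nat.le_mul_of_pos_left X hM
    omega
  set F := (Finset.Icc 1 Z).filter (fun p => p ∈ B ∧ ¬ p ∣ M) with hF
  have hFB : (F.card : ℝ) ≤ 1 / (4 * (K + 1) * M) * Z := by
    refine le_trans ?_ (hZ₀ Z hZZ)
    exact_mod_cast Finset.card_le_card (fun p hp => by
      simp only [hF, Finset.mem_filter] at hp ⊢
      exact ⟨hp.1, hp.2.1⟩)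
  have hFs : ∑ p ∈ F, 1 / (p : ℝ) ≤ 1 / (4 * (K + 1)) := by
    refine hy F fun p hp => ?_
    simp only [hF, Finset.mem_filter] at hp
    refine ⟨hp.2.1, ?_⟩
    by_contra h
    exact hp.2.2 (hyM p (hBp p hp.2.1) (by omega))
  by_contra! hcon
  have hcover : Finset.range X ⊆ (Finset.range K).biUnion fun j => F.biUnion fun p =>
      (Finset.range X).filter fun t => p ∣ (a + j + 1) + M * t := by
    intro t ht
    obtain ⟨j, hj, p, hpB, hpd, hpM⟩ := hcon (a + M * t) (by simp [Nat.ModEq])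
    have hpd' : p ∣ (a + j + 1) + M * t := by
      rwa [show a + j + 1 + M * t = a + M * t + j + 1 by ring]
    simp only [Finset.mem_biUnion, Finset.mem_filter]
    refine ⟨j, hj, p, ?_, ht, hpd'⟩
    simp only [hF, Finset.mem_filter, Finset.mem_Icc]
    refine ⟨⟨(hBp p hpB).one_le, ?_⟩, hpB, hpM⟩
    have h1 := Nat.le_of_dvd (by omega) hpd'
    have h2 : M * t ≤ M * X := Nat.mul_le_mul_left M (Finset.mem_range.1 ht).le
    have h3 := Finset.mem_range.1 hj
    omega
  have hcard : (X : ℝ) ≤ ∑ j ∈ Finset.range K, ∑ p ∈ F, (X * (1 / (p : ℝ)) + 1) := by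
    have h1 := (Finset.card_le_card hcover).trans (Finset.card_biUnion_le.trans
      (Finset.sum_le_sum fun j _ => Finset.card_biUnion_le))
    rw [Finset.card_range] at h1
    have h2 : (X : ℝ) ≤ ∑ j ∈ Finset.range K, ∑ p ∈ F,
        (((Finset.range X).filter fun t => p ∣ (a + j + 1) + M * t).card : ℝ) := by
      exact_mod_cast h1
    refine h2.trans (Finset.sum_le_sum fun j _ => Finset.sum_le_sum fun p hp => ?_)
    simp only [hF, Finset.mem_filter] at hp
    exact card_filter_dvd_progression_le (hBp p hp.2.1).pos
      ((Nat.Prime.coprime_iff_not_dvd (hBp p hp.2.1)).2 hp.2.2) _ _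
  rw [Finset.sum_const, Finset.card_range, nsmul_eq_mul, Finset.sum_add_distrib, ← Finset.mul_sum,
    Finset.sum_const, nsmul_eq_mul, mul_one] at hcard
  have hXpos : (0 : ℝ) < X := by rw [hX]; positivity
  have h5 : (K : ℝ) * (X * ∑ p ∈ F, 1 / (p : ℝ)) ≤ X / 4 := by
    calc (K : ℝ) * (X * ∑ p ∈ F, 1 / (p : ℝ)) ≤ (K + 1) * (X * (1 / (4 * (K + 1)))) := by
          gcongr
          linarith
      _ = X / 4 := by field_simp
  have h6 : (K : ℝ) * F.card ≤ X / 2 := by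
    have hZr : (Z : ℝ) ≤ 2 * (M * X) := by
      have h7 : Z ≤ 2 * (M * X) := by
        have : X ≤ M * X := Nat.le_mul_of_pos_left X hM
        omega
      exact_mod_cast h7
    calc (K : ℝ) * F.card ≤ (K + 1) * (1 / (4 * (K + 1) * M) * (2 * (M * X))) := by
          refine mul_le_mul (by linarith) (hFB.trans ?_) (by positivity) (by positivity)
          exact mul_le_mul_of_nonneg_left hZr (by positivity)
      _ = X / 2 := by field_simp; ring
  linarith

/-! ### Sign functions, valuations and local conditions -/

theorem eq_of_eq_on_primeFactors {f g : ℕ → ℤ}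
    (hf : ∀ a b : ℕ, 0 < a → 0 < b → f (a * b) = f a * f b)
    (hg : ∀ a b : ℕ, 0 < a → 0 < b → g (a * b) = g a * g b) (h1 : f 1 = g 1) {n : ℕ} (hn : 0 < n)
    (h : ∀ p, p.Prime → p ∣ n → f p = g p) : f n = g n := by
  induction n using Nat.recOnMul with
  | zero => omega
  | one => exact h1
  | prime p hp => exact h p hp dvd_rfl
  | mul a b iha ihb =>
    have ha := Nat.pos_of_mul_pos_right hn
    have hb := Nat.pos_of_mul_pos_left hn
    rw [hf a b ha hb, hg a b ha hb, iha ha fun p hp hd => h p hp (hd.mul_right b),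
      ihb hb fun p hp hd => h p hp (hd.mul_left a)]

theorem exists_signFunction (s : ℕ → ℤ) (hs : ∀ p, p.Prime → s p = 1 ∨ s p = -1) :
    ∃ g, IsSignCompletelyMultiplicative g ∧ ∀ p, p.Prime → g p = s p := by
  have hmul : ∀ a b : ℕ, 0 < a → 0 < b → ((a * b).primeFactorsList.map s).prod
      = (a.primeFactorsList.map s).prod * (b.primeFactorsList.map s).prod := fun a b ha hb => by
    rw [((Nat.perm_primeFactorsList_mul ha.ne' hb.ne').map s).prod_eq, List.map_append,
      List.prod_append]
  refine ⟨fun n => (n.primeFactorsList.map s).prod, ⟨fun n hn => ?_, hmul⟩, fun p hp => ?_⟩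
  · induction n using Nat.recOnMul with
    | zero => omega
    | one => simp
    | prime p hp => simpa [Nat.primeFactorsList_prime hp] using hs p hp
    | mul a b iha ihb =>
      have ha := Nat.pos_of_mul_pos_right hn
      have hb := Nat.pos_of_mul_pos_left hn
      rw [hmul a b ha hb]
      rcases iha ha with h | h <;> rcases ihb hb with h' | h' <;> simp [h, h']
  · simp [Nat.primeFactorsList_prime hp]

/-- The parity sign `∏_{p ∈ P} (-1)^{v_p(n)}`. -/
def valuationSign (P : Finset ℕ) (n : ℕ) : ℤ := ∏ p ∈ P, (-1) ^ n.factorization p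

theorem valuationSign_mul (P : Finset ℕ) (a b : ℕ) (ha : 0 < a) (hb : 0 < b) :
    valuationSign P (a * b) = valuationSign P a * valuationSign P b := by
  simp only [valuationSign, Nat.factorization_mul ha.ne' hb.ne', Finsupp.add_apply, pow_add,
    Finset.prod_mul_distrib]

theorem valuationSign_one (P : Finset ℕ) : valuationSign P 1 = 1 := by
  simp [valuationSign]

theorem valuationSign_prime (P : Finset ℕ) {r : ℕ} (hr : r.Prime) :
    valuationSign P r = if r ∈ P then -1 else 1 := by
  have : ∀ p ∈ P, ((-1 : ℤ)) ^ r.factorization p = if r = p then -1 else 1 := fun p _ => by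
    rw [hr.factorization, Finsupp.single_apply]
    split_ifs <;> simp
  rw [valuationSign, Finset.prod_congr rfl this, Finset.prod_ite_eq]

/-- A residue class modulo `p ^ 3` in which the only multiple of `p` in the window is at a
prescribed place and has prescribed valuation. -/
theorem exists_residue_factorization {p K j₀ e : ℕ} (hp : p.Prime) (hK : K ≤ p) (hj₀ : j₀ < K)
    (he : 0 < e) (he3 : e < 3) :
    ∃ r, ∀ n, n ≡ r [MOD p ^ 3] → ∀ j < K,
      (n + j + 1).factorization p = if j = j₀ then e else 0 := by
  have hle : j₀ + 1 ≤ p ^ 3 * (j₀ + 1) := Nat.le_mul_of_pos_left _ (pow_pos hp.pos 3)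
  -- This forces `n + j₀ + 1 ≡ p ^ e` modulo `p ^ 3`; the extra multiple of `p ^ 3` keeps the
  -- subtraction from truncating.
  refine ⟨p ^ e + p ^ 3 * (j₀ + 1) - (j₀ + 1), fun n hn j hj => ?_⟩
  have h1 : n + j₀ + 1 ≡ p ^ e [MOD p ^ 3] := by
    have h2 := hn.add_right (j₀ + 1)
    rw [Nat.sub_add_cancel (by omega)] at h2
    refine h2.trans ?_
    simp [Nat.ModEq]
  have hdvd : p ∣ n + j₀ + 1 := by
    have h2 := h1.of_dvd (dvd_pow_self p (by norm_num : 3 ≠ 0))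
    exact (Nat.modEq_zero_iff_dvd).1
      (h2.trans ((Nat.modEq_zero_iff_dvd).2 (dvd_pow_self p he.ne')))
  split_ifs with hjj
  · subst hjj
    apply le_antisymm
    · by_contra hlt
      have h3 : p ^ (e + 1) ∣ n + j + 1 :=
        (hp.pow_dvd_iff_le_factorization (by omega)).2 (by omega)
      have h4 := (Nat.modEq_zero_iff_dvd).1 (((h1.of_dvd (pow_dvd_pow p (by omega : e + 1 ≤ 3))).symm).trans
        ((Nat.modEq_zero_iff_dvd).2 h3))
      have := (Nat.pow_dvd_pow_iff_le_right hp.one_lt).1 h4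
      omega
    · rw [← hp.pow_dvd_iff_le_factorization (by omega)]
      exact (Nat.modEq_zero_iff_dvd).1 ((h1.of_dvd (pow_dvd_pow p (by omega : e ≤ 3))).trans
        ((Nat.modEq_zero_iff_dvd).2 dvd_rfl))
  · apply Nat.factorization_eq_zero_of_not_dvd
    intro hd
    rcases lt_or_gt_of_ne hjj with h | h
    · have h5 := (Nat.dvd_sub hdvd hd)
      have := Nat.le_of_dvd (by omega) h5
      omega
    · have h5 := (Nat.dvd_sub hd hdvd)
      have := Nat.le_of_dvd (by omega) h5
      omega

theorem exists_mul_coprime_decomposition {D : ℕ} (n : ℕ) (hn : 0 < n) :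
    ∃ A C, n = A * C ∧ A ∣ D ^ n ∧ C.Coprime D := by
  induction n using Nat.strong_induction_on with
  | _ n ih =>
    by_cases hc : n.Coprime D
    · exact ⟨1, n, by simp, one_dvd _, hc⟩
    · obtain ⟨p, hp, hpn, hpD⟩ := Nat.Prime.not_coprime_iff_dvd.1 hc
      obtain ⟨m, rfl⟩ := hpn
      have hm : 0 < m := Nat.pos_of_mul_pos_left hn
      have hlt : m < p * m := (Nat.lt_mul_iff_one_lt_left hm).2 hp.one_lt
      obtain ⟨A, C, h1, h2, h3⟩ := ih m hlt hm
      refine ⟨p * A, C, by rw [mul_assoc, ← h1], ?_, h3⟩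
      exact (mul_dvd_mul hpD h2).trans (by rw [← pow_succ']; exact pow_dvd_pow D hlt)

/-! ### Constructing a long run -/

theorem exists_run_of_card_exceptional {f c : ℕ → ℤ} (hf : IsSignCompletelyMultiplicative f)
    {q : ℕ} (hq : 0 < q) (hc1 : c 1 = 1) (hcmul : ∀ a b, c (a * b) = c a * c b)
    (hcper : ∀ a b, a ≡ b [MOD q] → c a = c b)
    (hcunit : ∀ a, a.Coprime q → c a = 1 ∨ c a = -1)
    (hB : Summable ({p : ℕ | p.Prime ∧ f p ≠ c p}.indicator fun p : ℕ => 1 / (p : ℝ)))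
    {K : ℕ} {P : Finset ℕ} (hP : ∀ p ∈ P, p.Prime ∧ K ≤ p ∧ ¬ p ∣ q ∧ f p ≠ c p)
    (hKP : K ≤ 2 * P.card) :
    ∃ n, ∀ j < K, f (n + j + 1) = 1 := by
  classical
  rcases Nat.eq_zero_or_pos K with rfl | hK
  · exact ⟨0, by simp⟩
  -- It matters that `y` is fixed before the modulus: the modulus depends on `n₀`, hence on `g`,
  -- hence on `D`, which is built from `y`.
  obtain ⟨y, hy⟩ := exists_modEq_sieved (B := {p : ℕ | p.Prime ∧ f p ≠ c p}) (fun p hp => hp.1) hB K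
  set T := (Finset.range (y + 1)).filter (fun p => p.Prime ∧ p ∉ P) with hT
  set D := q * ∏ p ∈ T, p with hD
  have hD0 : 0 < D := Nat.mul_pos hq (Finset.prod_pos fun p hp => (Finset.mem_filter.1 hp).2.1.pos)
  have hPD : ∀ p ∈ P, ¬ p ∣ D := by
    intro p hp hd
    have hpp := (hP p hp).1
    rcases (hpp.dvd_mul).1 hd with h | h
    · exact (hP p hp).2.2.1 h
    · obtain ⟨r, hr, hpr⟩ := (hpp.prime.dvd_finsetProd_iff _).1 h
      have hr' := (Finset.mem_filter.1 hr).2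
      rw [(Nat.prime_dvd_prime_iff_eq hpp hr'.1).1 hpr] at hp
      exact hr'.2 hp
  obtain ⟨g, hg, hgp⟩ := exists_signFunction (fun p => if p ∣ D then f p else if c p = 1 then 1 else -1)
    (fun p hp => by
      split_ifs
      · exact hf.sign p hp.pos
      · exact Or.inl rfl
      · exact Or.inr rfl)
  have hcop : ∀ {C : ℕ}, C.Coprime D → C.Coprime q := fun h => Nat.Coprime.coprime_dvd_right
    (Dvd.intro _ rfl) h
  have hgf : ∀ p, p.Prime → p ∣ D → g p = f p := fun p hp hd => by rw [hgp p hp, if_pos hd]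
  have hgc : ∀ p, p.Prime → ¬ p ∣ D → g p = c p := fun p hp hd => by
    rw [hgp p hp, if_neg hd]
    rcases hcunit p (hcop ((hp.coprime_iff_not_dvd).2 hd)) with h | h <;> simp [h]
  obtain ⟨n₀, hn₀⟩ := hg.exists_window_sum_nonneg K
  set Neg := (Finset.range K).filter (fun j => g (n₀ + j + 1) = -1) with hNeg
  have hcard : Neg.card ≤ P.card := by
    have h1 : ∑ j ∈ Finset.range K, g (n₀ + j + 1) = K - 2 * (Neg.card : ℤ) := by
      have h2 : ∀ j ∈ Finset.range K, g (n₀ + j + 1)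
          = 1 - 2 * (if g (n₀ + j + 1) = -1 then 1 else 0) := fun j _ => by
        rcases hg.sign (n₀ + j + 1) (by omega) with h | h <;> simp [h]
      rw [Finset.sum_congr rfl h2, Finset.sum_sub_distrib, ← Finset.mul_sum, Finset.sum_boole]
      simp [hNeg]
    omega
  obtain ⟨ι, hιP, hιinj⟩ : ∃ ι : ℕ → ℕ, (∀ j ∈ Neg, ι j ∈ P) ∧
      ∀ i ∈ Neg, ∀ j ∈ Neg, ι i = ι j → i = j := by
    obtain ⟨e⟩ : Nonempty (Neg ↪ P) := Function.Embedding.nonempty_of_card_le (by simpa using hcard)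
    refine ⟨fun j => if h : j ∈ Neg then (e ⟨j, h⟩ : ℕ) else 0, fun j hj => ?_, fun i hi j hj h => ?_⟩
    · simp [hj]
    · simp only [hi, hj, dif_pos] at h
      simpa using e.injective (Subtype.ext h)
  have hres : ∀ p, ∃ r, p ∈ P → ∀ n, n ≡ r [MOD p ^ 3] → ∀ j < K,
      ((-1 : ℤ)) ^ (n + j + 1).factorization p = if j ∈ Neg ∧ ι j = p then -1 else 1 := by
    intro p
    by_cases hp : p ∈ P
    swap
    · exact ⟨0, fun h => absurd h hp⟩
    by_cases hex : ∃ j ∈ Neg, ι j = p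
    · obtain ⟨j₀, hj₀, hj₀p⟩ := hex
      obtain ⟨r, hr⟩ := exists_residue_factorization (hP p hp).1 (hP p hp).2.1
        (Finset.mem_range.1 (Finset.mem_filter.1 hj₀).1) one_pos (by norm_num)
      refine ⟨r, fun _ n hn j hj => ?_⟩
      rw [hr n hn j hj]
      by_cases hjj : j = j₀
      · rw [if_pos hjj, if_pos (by rw [hjj]; exact ⟨hj₀, hj₀p⟩), pow_one]
      · rw [if_neg hjj, if_neg (fun h => hjj (hιinj j h.1 j₀ hj₀ (h.2.trans hj₀p.symm))), pow_zero]
    -- An unused prime is parked at place `0` with even valuation, hence no effect on sign. It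
    -- cannot always be kept out of the window, since `p = K` is allowed.
    · obtain ⟨r, hr⟩ := exists_residue_factorization (hP p hp).1 (hP p hp).2.1 hK
        (e := 2) (by norm_num) (by norm_num)
      refine ⟨r, fun _ n hn j hj => ?_⟩
      rw [hr n hn j hj, if_neg (fun h => hex ⟨j, h⟩)]
      split_ifs <;> simp
  choose r hr using hres
  -- Every entry of the model window is at most `L`, so its `D`-part divides `D ^ L`, and one more
  -- factor `D` fixes the cofactor modulo `D`.
  set L := n₀ + K with hL
  have hcopP : Set.Pairwise (P : Set ℕ) (Function.onFun Nat.Coprime fun p => p ^ 3) := by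
    intro a ha b hb hab
    exact Nat.Coprime.pow _ _ ((Nat.coprime_primes (hP a ha).1 (hP b hb).1).2 hab)
  obtain ⟨a₁, ha₁⟩ := Nat.chineseRemainderOfFinset r (fun p => p ^ 3) (t := P)
    (fun p hp => pow_ne_zero 3 (hP p hp).1.ne_zero) hcopP
  have hcopD : (D ^ (L + 1)).Coprime (∏ p ∈ P, p ^ 3) := by
    refine Nat.Coprime.prod_right fun p hp => Nat.Coprime.pow _ _ ?_
    exact (((hP p hp).1.coprime_iff_not_dvd).2 (hPD p hp)).symm
  obtain ⟨a, ha, ha'⟩ := Nat.chineseRemainder hcopD n₀ a₁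
  have hpM : ∀ p, p.Prime → (p ∣ D ^ (L + 1) * ∏ p ∈ P, p ^ 3 ↔ p ∣ D ∨ p ∈ P) := by
    intro p hp
    rw [hp.dvd_mul]
    refine or_congr ⟨hp.dvd_of_dvd_pow, fun h => dvd_pow h (Nat.succ_ne_zero L)⟩ ⟨fun h => ?_, fun h => ?_⟩
    · obtain ⟨s, hs, hps⟩ := (hp.prime.dvd_finsetProd_iff _).1 h
      rwa [(Nat.prime_dvd_prime_iff_eq hp (hP s hs).1).1 (hp.dvd_of_dvd_pow hps)]
    · exact (dvd_pow_self p (by norm_num)).trans (Finset.dvd_prod_of_mem (fun p => p ^ 3) h)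
  obtain ⟨n, hna, hn⟩ := hy (D ^ (L + 1) * ∏ p ∈ P, p ^ 3) a
    (Nat.mul_pos (pow_pos hD0 _) (Finset.prod_pos fun p hp => pow_pos (hP p hp).1.pos 3))
    (fun p hp hpy => (hpM p hp).2 (by
      by_cases h : p ∈ P
      · exact Or.inr h
      · exact Or.inl ((Finset.dvd_prod_of_mem (fun p => p) (Finset.mem_filter.2
          ⟨Finset.mem_range.2 (by omega), hp, h⟩)).trans (Dvd.intro_left q rfl))))
  have hnD : n ≡ n₀ [MOD D ^ (L + 1)] := (hna.of_dvd (Dvd.intro _ rfl)).trans ha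
  have hnP : ∀ p ∈ P, n ≡ r p [MOD p ^ 3] := fun p hp =>
    (((hna.of_dvd (Dvd.intro_left _ rfl)).trans ha').of_dvd
      (Finset.dvd_prod_of_mem (fun p => p ^ 3) hp)).trans (ha₁ p hp)
  refine ⟨n, fun j hj => ?_⟩
  obtain ⟨A, C, hAC, hAD, hCD⟩ := exists_mul_coprime_decomposition (D := D) (n₀ + j + 1) (by omega)
  have hACpos : 0 < A * C := by omega
  have hA : 0 < A := Nat.pos_of_mul_pos_right hACpos
  have hC : 0 < C := Nat.pos_of_mul_pos_left hACpos
  have hN : n + j + 1 ≡ A * C [MOD A * D] := by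
    rw [← hAC]
    refine ((hnD.add_right j).add_right 1).of_dvd ?_
    rw [pow_succ]
    exact mul_dvd_mul (hAD.trans (pow_dvd_pow D (by omega))) dvd_rfl
  obtain ⟨N, hNA⟩ : A ∣ n + j + 1 := (Nat.modEq_zero_iff_dvd).1
    ((hN.of_dvd (Dvd.intro _ rfl)).trans ((Nat.modEq_zero_iff_dvd).2 (Dvd.intro _ rfl)))
  have hNC : N ≡ C [MOD D] := by
    rw [hNA] at hN
    exact Nat.ModEq.mul_left_cancel' hA.ne' hN
  have hND : N.Coprime D := by
    have := hNC.gcd_eq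
    rw [Nat.Coprime, this]
    exact hCD
  have hNpos : 0 < N := Nat.pos_of_ne_zero (by rintro rfl; omega)
  have hprimeA : ∀ p, p.Prime → p ∣ A → p ∣ D := fun p hp h => hp.dvd_of_dvd_pow (h.trans hAD)
  have hfA : g A = f A := eq_of_eq_on_primeFactors hg.mul hf.mul (by rw [hg.map_one, hf.map_one]) hA
    fun p hp h => hgf p hp (hprimeA p hp h)
  have hnotD : ∀ {m : ℕ}, m.Coprime D → ∀ p, p.Prime → p ∣ m → ¬ p ∣ D := fun hm p hp h h' =>
    hp.one_lt.ne' (Nat.dvd_one.1 (hm ▸ Nat.dvd_gcd h h'))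
  have hgC : g C = c C := eq_of_eq_on_primeFactors hg.mul (fun a b _ _ => hcmul a b)
    (by rw [hg.map_one, hc1]) hC fun p hp h => hgc p hp (hnotD hCD p hp h)
  have hlA : valuationSign P A = 1 := eq_of_eq_on_primeFactors (g := fun _ => 1)
    (valuationSign_mul P) (by simp) (valuationSign_one P) hA fun p hp h => by
      rw [valuationSign_prime P hp, if_neg fun h' => hPD p h' (hprimeA p hp h)]
  -- A prime factor of `N` is either in `P`, where `f = -c`, or by the sieve a prime where `f = c`.
  have hfN : f N = c N * valuationSign P N := by
    refine eq_of_eq_on_primeFactors (g := fun m => c m * valuationSign P m) hf.mul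
      (fun a b ha hb => by rw [hcmul, valuationSign_mul P a b ha hb]; ring)
      (by rw [hf.map_one, hc1, valuationSign_one, one_mul]) hNpos fun p hp h => ?_
    have hpD := hnotD hND p hp h
    rw [valuationSign_prime P hp]
    by_cases hpP : p ∈ P
    · rw [if_pos hpP]
      have hne := (hP p hpP).2.2.2
      rcases hf.sign p hp.pos with h1 | h1 <;>
        rcases hcunit p (hcop ((hp.coprime_iff_not_dvd).2 hpD)) with h2 | h2 <;>
        simp [h1, h2] at hne ⊢
    · rw [if_neg hpP, mul_one]
      by_contra hne
      have h3 := hn j (Finset.mem_range.2 hj) p ⟨hp, hne⟩ (hNA ▸ h.mul_left A)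
      exact ((hpM p hp).1 h3).elim hpD hpP
  have hlN : valuationSign P N = if j ∈ Neg then -1 else 1 := by
    have hl : valuationSign P N = valuationSign P (n + j + 1) := by
      rw [hNA, valuationSign_mul P A N hA hNpos, hlA, one_mul]
    rw [hl, valuationSign, Finset.prod_congr rfl fun p hp => hr p hp n (hnP p hp) j hj]
    by_cases hjN : j ∈ Neg
    · simp [hjN, hιP j hjN]
    · simp [hjN]
  have hcN : c N = c C := hcper N C (hNC.of_dvd (Dvd.intro _ rfl))
  have hfin : f (n + j + 1) = g (n₀ + j + 1) * if j ∈ Neg then -1 else 1 := by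
    rw [hNA, hf.mul A N hA hNpos, hfN, hcN, hlN, hAC, hg.mul A C hA hC, hfA, hgC, mul_assoc]
  rw [hfin]
  by_cases hjN : j ∈ Neg
  · rw [if_pos hjN, (Finset.mem_filter.1 hjN).2]; norm_num
  · rw [if_neg hjN, mul_one]
    exact (hg.sign _ (by omega)).resolve_right fun h =>
      hjN (Finset.mem_filter.2 ⟨Finset.mem_range.2 hj, h⟩)

/-! ### Pretentious distance and real characters -/

theorem pretentiousTo_iff_bounded {f g : ℕ → ℂ}
    (h : ∀ p, p.Prime → (f p * (starRingEnd ℂ) (g p)).re ≤ 1) :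
    PretentiousTo f g ↔ ∃ C : ℝ, ∀ N : ℕ, ∑ p ∈ (Finset.Icc 1 N).filter Nat.Prime,
      (1 - (f p * (starRingEnd ℂ) (g p)).re) / (p : ℝ) ≤ C := by
  have hterm : ∀ p, p.Prime → 0 ≤ (1 - (f p * (starRingEnd ℂ) (g p)).re) / (p : ℝ) :=
    fun p hp => div_nonneg (sub_nonneg.2 (h p hp)) (Nat.cast_nonneg p)
  constructor
  · intro hO
    obtain ⟨c, hc⟩ := hO.bound
    obtain ⟨x₀, hx₀⟩ := eventually_atTop.1 hc
    refine ⟨c ^ 2, fun N => ?_⟩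
    -- The partial sums are monotone, so the eventual bound passes down to every `N`.
    have h1 := hx₀ (max x₀ N) (le_max_left _ _)
    rw [norm_one, mul_one, Real.norm_eq_abs] at h1
    have h2 := (Real.sqrt_le_iff.1 ((le_abs_self _).trans h1)).2
    refine le_trans (Finset.sum_le_sum_of_subset_of_nonneg ?_ ?_) h2
    · refine Finset.filter_subset_filter _ (Finset.Icc_subset_Icc_right ?_)
      exact Nat.le_floor (le_max_right _ _)
    · exact fun p hp _ => hterm p (Finset.mem_filter.1 hp).2
  · rintro ⟨C, hC⟩
    refine IsBigO.of_bound (Real.sqrt C) (Eventually.of_forall fun x => ?_)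
    rw [norm_one, mul_one, Real.norm_eq_abs, pretentiousDist, abs_of_nonneg (Real.sqrt_nonneg _)]
    exact Real.sqrt_le_sqrt (hC _)

theorem IsSignCompletelyMultiplicative.re_mul_conj_le_one {f : ℕ → ℤ}
    (hf : IsSignCompletelyMultiplicative f) {p : ℕ} (hp : p.Prime) {z : ℂ} (hz : ‖z‖ ≤ 1) :
    ((f p : ℂ) * (starRingEnd ℂ) z).re ≤ 1 := by
  refine (Complex.re_le_norm _).trans ?_
  rw [norm_mul, RCLike.norm_conj]
  rcases hf.sign p hp.pos with h | h <;> simpa [h] using hz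

theorem PretentiousTo.congr_away {f : ℕ → ℤ} (hf : IsSignCompletelyMultiplicative f)
    {g g' : ℕ → ℂ} (hg : ∀ n, 0 < n → ‖g n‖ ≤ 1) (hg' : ∀ n, 0 < n → ‖g' n‖ ≤ 1) {q : ℕ} (hq : 0 < q)
    (hgg' : ∀ p, p.Prime → ¬ p ∣ q → g p = g' p) (h : PretentiousTo (fun n => (f n : ℂ)) g) :
    PretentiousTo (fun n => (f n : ℂ)) g' := by
  rw [pretentiousTo_iff_bounded fun p hp => hf.re_mul_conj_le_one hp (hg p hp.pos)] at h
  rw [pretentiousTo_iff_bounded fun p hp => hf.re_mul_conj_le_one hp (hg' p hp.pos)]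
  obtain ⟨C, hC⟩ := h
  refine ⟨C + ∑ p ∈ q.divisors, 2, fun N => ?_⟩
  have hle : ∀ p ∈ (Finset.Icc 1 N).filter Nat.Prime,
      (1 - ((f p : ℂ) * (starRingEnd ℂ) (g' p)).re) / (p : ℝ)
        ≤ (1 - ((f p : ℂ) * (starRingEnd ℂ) (g p)).re) / (p : ℝ) + if p ∣ q then 2 else 0 := by
    intro p hp
    have hpp := (Finset.mem_filter.1 hp).2
    by_cases hd : p ∣ q
    · rw [if_pos hd]
      have h1 : 0 ≤ (1 - ((f p : ℂ) * (starRingEnd ℂ) (g p)).re) / (p : ℝ) :=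
        div_nonneg (sub_nonneg.2 (hf.re_mul_conj_le_one hpp (hg p hpp.pos))) (Nat.cast_nonneg p)
      have h2 : (1 - ((f p : ℂ) * (starRingEnd ℂ) (g' p)).re) / (p : ℝ) ≤ 2 := by
        rw [div_le_iff₀ (by exact_mod_cast hpp.pos)]
        -- Applied to `-g' p`, the upper bound on the real part becomes the lower bound `-1`.
        have h3 := hf.re_mul_conj_le_one hpp (z := -g' p) (by simpa using hg' p hpp.pos)
        rw [map_neg, mul_neg, Complex.neg_re] at h3
        have h4 : (1 : ℝ) ≤ p := by exact_mod_cast hpp.one_le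
        linarith
      linarith
    · rw [if_neg hd, hgg' p hpp hd, add_zero]
  refine (Finset.sum_le_sum hle).trans ?_
  rw [Finset.sum_add_distrib]
  refine add_le_add (hC N) ?_
  rw [← Finset.sum_filter]
  refine Finset.sum_le_sum_of_subset_of_nonneg (fun p hp => ?_) (fun _ _ _ => by norm_num)
  exact Nat.mem_divisors.2 ⟨(Finset.mem_filter.1 hp).2, hq.ne'⟩

theorem IsRealCharacter.eq_one_or_eq_neg_one {q : ℕ} {χ : DirichletCharacter ℂ q}
    (h : IsRealCharacter χ) {a : ZMod q} (ha : IsUnit a) : χ a = 1 ∨ χ a = -1 := by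
  obtain ⟨u, rfl⟩ := ha
  have h1 := DirichletCharacter.unit_norm_eq_one χ u
  have h2 : χ (u : ZMod q) = ((χ (u : ZMod q)).re : ℂ) := Complex.ext rfl (by simpa using h u)
  rw [h2, Complex.norm_real, Real.norm_eq_abs, abs_eq zero_le_one] at h1
  rw [h2]
  rcases h1 with h1 | h1 <;> simp [h1]

theorem IsRealCharacter.exists_int {q : ℕ} {χ : DirichletCharacter ℂ q} (h : IsRealCharacter χ) :
    ∃ c : ℕ → ℤ, ∀ n : ℕ, (c n : ℂ) = χ (n : ZMod q) := by
  have : ∀ n : ℕ, ∃ m : ℤ, (m : ℂ) = χ (n : ZMod q) := fun n => by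
    by_cases hu : IsUnit (n : ZMod q)
    · rcases h.eq_one_or_eq_neg_one hu with h1 | h1
      · exact ⟨1, by simp [h1]⟩
      · exact ⟨-1, by simp [h1]⟩
    · exact ⟨0, by simp [χ.map_nonunit hu]⟩
  choose c hc using this
  exact ⟨c, hc⟩

theorem isRealCharacter_of_sq_eq_one {q : ℕ} {χ : DirichletCharacter ℂ q} (h : χ ^ 2 = 1) :
    IsRealCharacter χ := by
  intro a
  by_cases hu : IsUnit a
  · have h1 : χ a ^ 2 = 1 := by
      rw [← MulChar.pow_apply' χ two_ne_zero, h, MulChar.one_apply hu]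
    rcases mul_self_eq_one_iff.1 ((sq _).symm.trans h1) with h2 | h2 <;> simp [h2]
  · simp [χ.map_nonunit hu]

/-- A prime where `f` and `c` disagree contributes `1 / p` (when `c p = 0`) or `2 / p` to the
squared distance. -/
theorem summable_one_div_of_pretentious {f c : ℕ → ℤ} (hf : IsSignCompletelyMultiplicative f)
    (hc : ∀ p, p.Prime → c p = 0 ∨ c p = 1 ∨ c p = -1)
    (h : PretentiousTo (fun n => (f n : ℂ)) (fun n => (c n : ℂ))) :
    Summable ({p : ℕ | p.Prime ∧ f p ≠ c p}.indicator fun p : ℕ => 1 / (p : ℝ)) := by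
  classical
  have hnorm : ∀ p, p.Prime → ‖(c p : ℂ)‖ ≤ 1 := fun p hp => by
    rcases hc p hp with h | h | h <;> simp [h]
  rw [pretentiousTo_iff_bounded fun p hp => hf.re_mul_conj_le_one hp (hnorm p hp)] at h
  obtain ⟨C, hC⟩ := h
  refine summable_of_sum_range_le (c := C)
    (fun n => Set.indicator_nonneg (fun p _ => by positivity) n) fun N => ?_
  refine le_trans ?_ (hC N)
  rw [Finset.sum_indicator_eq_sum_filter]
  refine le_trans (Finset.sum_le_sum (g := fun p : ℕ =>
    (1 - ((f p : ℂ) * (starRingEnd ℂ) (c p : ℂ)).re) / (p : ℝ)) fun p hp => ?_)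
    (Finset.sum_le_sum_of_subset_of_nonneg (fun p hp => ?_) fun p hp _ => ?_)
  · obtain ⟨hpp, hne⟩ := (Finset.mem_filter.1 hp).2
    refine div_le_div_of_nonneg_right ?_ (Nat.cast_nonneg p)
    rcases hf.sign p hpp.pos with h1 | h1 <;> rcases hc p hpp with h2 | h2 | h2 <;>
      simp [h1, h2] at hne ⊢
  · obtain ⟨hpN, hpp, -⟩ := Finset.mem_filter.1 hp
    exact Finset.mem_filter.2 ⟨Finset.mem_Icc.2 ⟨hpp.one_le, (Finset.mem_range.1 hpN).le⟩, hpp⟩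
  · have hpp := (Finset.mem_filter.1 hp).2
    exact div_nonneg (sub_nonneg.2 (hf.re_mul_conj_le_one hpp (hnorm p hpp))) (Nat.cast_nonneg p)

/-! ### Bounding the number of exceptional primes -/

theorem IsLengthFunction.not_exists_longer {k : ℕ} {f : ℕ → ℤ} (hk : IsLengthFunction k f) :
    ¬ ∃ n, ∀ j < k + 1, f (n + j + 1) = 1 := by
  rintro ⟨n, hn⟩
  have hmem : k + 1 ∈ {m : ℕ | 0 < m ∧ ∃ n : ℕ, ∀ j ∈ Finset.Icc 1 m, f (n + j) = 1} := by
    refine ⟨k.succ_pos, n, fun j hj => ?_⟩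
    obtain ⟨h1, h2⟩ := Finset.mem_Icc.1 hj
    have := hn (j - 1) (by omega)
    rwa [show n + (j - 1) + 1 = n + j by omega] at this
  have h : k + 1 ≤ k := hk.2 hmem
  omega

theorem two_mul_card_exceptional_le {k : ℕ} {f : ℕ → ℤ} (hf : IsSignCompletelyMultiplicative f)
    (hk : IsLengthFunction k f) {q : ℕ} (hq : 0 < q) {χ : DirichletCharacter ℂ q}
    (hχ : IsRealCharacter χ)
    (h : PretentiousTo (fun n => (f n : ℂ)) (fun n => χ (n : ZMod q)))
    {P : Finset ℕ} (hP : (P : Set ℕ) ⊆ exceptionalPrimes k f χ) : 2 * P.card ≤ k := by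
  by_contra hlt
  obtain ⟨c, hc⟩ := hχ.exists_int
  have hunit : ∀ a : ℕ, a.Coprime q → c a = 1 ∨ c a = -1 := fun a ha => by
    have h1 := hχ.eq_one_or_eq_neg_one ((ZMod.isUnit_iff_coprime a q).2 ha)
    rw [← hc a] at h1
    exact_mod_cast h1
  refine hk.not_exists_longer (exists_run_of_card_exceptional hf hq (c := c) (P := P) ?_ ?_ ?_ hunit
    ?_ (fun p hp => ?_) (by omega))
  · have := hc 1
    rw [Nat.cast_one, map_one] at this
    exact_mod_cast this
  · intro a b
    have : ((c (a * b) : ℤ) : ℂ) = ((c a * c b : ℤ) : ℂ) := by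
      push_cast
      rw [hc, hc, hc, Nat.cast_mul, map_mul]
    exact_mod_cast this
  · intro a b hab
    have : ((c a : ℤ) : ℂ) = c b := by
      rw [hc, hc, (ZMod.natCast_eq_natCast_iff a b q).2 hab]
    exact_mod_cast this
  · refine summable_one_div_of_pretentious hf (fun p hp => ?_) (by simpa only [hc] using h)
    by_cases hpq : p ∣ q
    · left
      have h1 := hc p
      rw [χ.map_nonunit fun hu => (ZMod.isUnit_prime_iff_not_dvd hp).1 hu hpq] at h1
      exact_mod_cast h1
    · exact Or.inr (hunit p ((hp.coprime_iff_not_dvd).2 hpq))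
  · obtain ⟨h1, h2, h3, h4⟩ := hP hp
    refine ⟨h1, h2, h3, fun h5 => h4 ?_⟩
    rw [← hc p, h5]

/-! ### Long runs from Elliott's conjecture -/

/-- Without a run, the product of `1 + f (n + j + 1)` over `j < K` vanishes for every `n`. Expanding
it over subsets and summing over `n ≤ N`, the empty subset gives `N` while all others give `o(N)`.
-/
theorem exists_run_of_not_isPretentious (hE : ElliottConjecture) {f : ℕ → ℤ}
    (hf : IsSignCompletelyMultiplicative f) (hnp : ¬ IsPretentious (fun n => (f n : ℂ))) (K : ℕ) :
    ∃ n, ∀ j < K, f (n + j + 1) = 1 := by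
  classical
  by_contra! hcon
  have hcorr : ∀ S ∈ (Finset.range K).powerset.erase ∅,
      (fun x : ℝ => ∑ n ∈ Finset.Icc 1 ⌊x⌋₊, ∏ j ∈ S, (f (n + j + 1) : ℝ))
        =o[atTop] (fun x : ℝ => x) := by
    intro S hS
    have hSne : S.Nonempty := Finset.nonempty_iff_ne_empty.2 (Finset.ne_of_mem_erase hS)
    have hinj : ∀ i j : Fin S.card, i ≠ j →
        ((S.equivFin.symm i : ℕ) ≠ (S.equivFin.symm j : ℕ)) := fun i j hij h =>
      hij (S.equivFin.symm.injective (Subtype.ext h))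
    have h := hE S.card (fun _ => 1) (fun i => (S.equivFin.symm i : ℕ) + 1) hSne.card_pos
      (fun _ => one_pos) (fun _ => Nat.succ_pos _)
      (fun i j hij => fun h => hinj i j hij (by omega)) f hf hnp
    refine h.congr_left fun x => Finset.sum_congr rfl fun n _ => ?_
    rw [← Finset.prod_coe_sort S fun j => (f (n + j + 1) : ℝ),
      ← Equiv.prod_comp S.equivFin.symm]
    refine Finset.prod_congr rfl fun i _ => ?_
    rw [one_mul, ← add_assoc]
  have hzero : ∀ n, ∑ S ∈ (Finset.range K).powerset, ∏ j ∈ S, (f (n + j + 1) : ℝ) = 0 := by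
    intro n
    rw [← Finset.prod_one_add]
    obtain ⟨j, hj, hne⟩ := hcon n
    refine Finset.prod_eq_zero (Finset.mem_range.2 hj) ?_
    rw [(hf.sign (n + j + 1) (by omega)).resolve_left hne]
    norm_num
  have hsum := (IsLittleO.sum hcorr).comp_tendsto (tendsto_natCast_atTop_atTop (R := ℝ))
  have hneg : (fun N : ℕ => -(N : ℝ)) =o[atTop] (fun N : ℕ => (N : ℝ)) := by
    refine hsum.congr_left fun N => ?_
    rw [Function.comp, Finset.sum_apply]
    simp only [Nat.floor_natCast]
    rw [Finset.sum_comm]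
    have : ∀ n ∈ Finset.Icc 1 N, ∑ S ∈ (Finset.range K).powerset.erase ∅,
        ∏ j ∈ S, (f (n + j + 1) : ℝ) = -1 := fun n _ => by
      have h1 := Finset.add_sum_erase (Finset.range K).powerset
        (fun S => ∏ j ∈ S, (f (n + j + 1) : ℝ)) (Finset.empty_mem_powerset _)
      rw [hzero n, Finset.prod_empty] at h1
      linarith
    rw [Finset.sum_congr rfl this]
    simp
  rw [isLittleO_neg_left] at hneg
  refine isLittleO_irrefl ?_ hneg
  exact ((eventually_gt_atTop 0).mono fun N hN => by
    simpa using (Nat.pos_iff_ne_zero.1 hN)).frequently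

/-! ### Rigidity of twists via Euler products -/

/-- The left side is at most `(1 - u)² + 2u(1 - Re w)`; since `(1 - u)² ≥ 1/4`, the factor `(1 -
u)²` can be extracted at the cost of the constant `8`, and `1 + x ≤ exp x` finishes. It compares
Euler factors with `u = p ^ (-σ)`. -/
theorem normSq_one_sub_mul_le {w : ℂ} (hw : ‖w‖ ≤ 1) {u : ℝ} (hu0 : 0 ≤ u) (hu : u ≤ 1 / 2) :
    ‖1 - w * (u : ℂ)‖ ^ 2 ≤ (1 - u) ^ 2 * Real.exp (8 * (u * (1 - w.re))) := by
  have hw2 : w.re ^ 2 + w.im ^ 2 ≤ 1 := by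
    have h : ‖w‖ ^ 2 = w.re ^ 2 + w.im ^ 2 := by rw [Complex.sq_norm, Complex.normSq_apply]; ring
    rw [← h]
    exact pow_le_one₀ (norm_nonneg w) hw
  have hre : w.re ≤ 1 := (Complex.re_le_norm w).trans hw
  have h1 : ‖1 - w * (u : ℂ)‖ ^ 2 = (1 - w.re * u) ^ 2 + (w.im * u) ^ 2 := by
    rw [Complex.sq_norm, Complex.normSq_apply]
    simp
    ring
  have h2 : (0 : ℝ) ≤ u * (1 - w.re) := mul_nonneg hu0 (sub_nonneg.2 hre)
  have h3 : 1 / 4 ≤ (1 - u) ^ 2 := by nlinarith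
  have h4 := Real.add_one_le_exp (8 * (u * (1 - w.re)))
  have h5 : (1 - u) ^ 2 * (8 * (u * (1 - w.re)) + 1) ≤
      (1 - u) ^ 2 * Real.exp (8 * (u * (1 - w.re))) := mul_le_mul_of_nonneg_left h4 (sq_nonneg _)
  have h6 := mul_le_mul_of_nonneg_right h3 h2
  have h7 := mul_le_mul_of_nonneg_left hw2 (sq_nonneg u)
  rw [h1]
  nlinarith

theorem norm_zeta_sq_le_of_sum_le {q : ℕ} [NeZero q] {ψ : DirichletCharacter ℂ q} {τ C : ℝ}
    (hC : ∀ N : ℕ, ∑ p ∈ N.primesBelow,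
      (1 - (ψ (p : ZMod q) * (p : ℂ) ^ (Complex.I * (τ : ℂ))).re) / (p : ℝ) ≤ C)
    {σ : ℝ} (hσ : 1 < σ) :
    ‖riemannZeta σ‖ ^ 2 ≤ Real.exp (8 * C) * ‖ψ.LFunction (σ - Complex.I * τ)‖ ^ 2 := by
  have hσ1 : 1 < (σ : ℂ).re := by simpa using hσ
  have hσ2 : 1 < ((σ : ℂ) - Complex.I * τ).re := by simpa using hσ
  rw [DirichletCharacter.LFunction_eq_LSeries ψ hσ2]
  refine le_of_tendsto_of_tendsto' ((riemannZeta_eulerProduct hσ1).norm.pow 2)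
    (((DirichletCharacter.LSeries_eulerProduct ψ hσ2).norm.pow 2).const_mul _) fun N => ?_
  have hfactor : ∀ p ∈ N.primesBelow, ‖(1 - (p : ℂ) ^ (-(σ : ℂ)))⁻¹‖ ^ 2 ≤
      Real.exp (8 * ((1 - (ψ (p : ZMod q) * (p : ℂ) ^ (Complex.I * (τ : ℂ))).re) / (p : ℝ))) *
        ‖(1 - ψ (p : ZMod q) * (p : ℂ) ^ (-((σ : ℂ) - Complex.I * τ)))⁻¹‖ ^ 2 := by
    intro p hp
    have hpp := Nat.prime_of_mem_primesBelow hp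
    have hp0 : (0 : ℝ) < p := by exact_mod_cast hpp.pos
    have hp0' : (p : ℂ) ≠ 0 := by exact_mod_cast hpp.ne_zero
    have hp2 : (2 : ℝ) ≤ p := by exact_mod_cast hpp.two_le
    set w : ℂ := ψ (p : ZMod q) * (p : ℂ) ^ (Complex.I * (τ : ℂ)) with hw
    set u : ℝ := (p : ℝ) ^ (-σ) with hu
    have hwn : ‖w‖ ≤ 1 := by
      rw [hw, norm_mul, Complex.norm_natCast_cpow_of_pos hpp.pos]
      simpa using ψ.norm_le_one (p : ZMod q)
    have hu0 : 0 < u := Real.rpow_pos_of_pos hp0 _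
    have hup : u ≤ 1 / p := by
      rw [hu, one_div, ← Real.rpow_neg_one]
      exact Real.rpow_le_rpow_of_exponent_le (by linarith) (by linarith)
    have hu2 : u ≤ 1 / 2 := hup.trans (one_div_le_one_div_of_le two_pos hp2)
    have huC : (p : ℂ) ^ (-(σ : ℂ)) = (u : ℂ) := by
      rw [hu, Complex.ofReal_cpow hp0.le]
      simp
    have hwu : ψ (p : ZMod q) * (p : ℂ) ^ (-((σ : ℂ) - Complex.I * τ)) = w * u := by
      rw [← huC, hw, mul_assoc, ← Complex.cpow_add _ _ hp0']
      congr 2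
      ring
    have hre : 0 ≤ 1 - w.re := sub_nonneg.2 ((Complex.re_le_norm w).trans hwn)
    rw [huC, hwu, norm_inv, norm_inv, inv_pow, inv_pow]
    have h1 := normSq_one_sub_mul_le hwn hu0.le hu2
    have hne : 0 < ‖1 - w * (u : ℂ)‖ := by
      rw [norm_pos_iff, sub_ne_zero]
      intro h
      have h2 := congrArg norm h
      rw [norm_one, norm_mul, Complex.norm_real, Real.norm_of_nonneg hu0.le] at h2
      have := mul_le_mul_of_nonneg_right hwn hu0.le
      linarith
    have h3 : ‖1 - (u : ℂ)‖ ^ 2 = (1 - u) ^ 2 := by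
      rw [← Complex.ofReal_one, ← Complex.ofReal_sub, Complex.norm_real, Real.norm_eq_abs, sq_abs]
    rw [h3, ← div_eq_mul_inv, le_div_iff₀ (by positivity), inv_mul_le_iff₀ (by nlinarith)]
    refine h1.trans (mul_le_mul_of_nonneg_left (Real.exp_le_exp.2 ?_) (sq_nonneg _))
    have := mul_le_mul_of_nonneg_right hup hre
    rw [one_div_mul_eq_div] at this
    linarith
  rw [norm_prod, norm_prod, ← Finset.prod_pow, ← Finset.prod_pow]
  refine (Finset.prod_le_prod (fun p _ => by positivity) hfactor).trans ?_
  rw [Finset.prod_mul_distrib, ← Real.exp_sum, ← Finset.mul_sum]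
  gcongr
  exact hC N

/-- Otherwise the L-function is regular at `1 - iτ`. Multiplying the comparison with zeta by `(σ -
1)²` and letting `σ → 1⁺` gives `1 ≤ 0`. -/
theorem eq_one_and_eq_zero_of_sum_le {q : ℕ} [NeZero q] {ψ : DirichletCharacter ℂ q} {τ C : ℝ}
    (hC : ∀ N : ℕ, ∑ p ∈ N.primesBelow,
      (1 - (ψ (p : ZMod q) * (p : ℂ) ^ (Complex.I * (τ : ℂ))).re) / (p : ℝ) ≤ C) :
    ψ = 1 ∧ τ = 0 := by
  by_contra hcon
  have hdiff : DifferentiableAt ℂ ψ.LFunction (1 - Complex.I * τ) := by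
    refine DirichletCharacter.differentiableAt_LFunction ψ _ ?_
    by_cases hψ : ψ = 1
    · left
      have hτ : τ ≠ 0 := fun h => hcon ⟨hψ, h⟩
      simpa using hτ
    · exact Or.inr hψ
  have hcast : Tendsto (fun σ : ℝ => (σ : ℂ)) (nhdsWithin 1 (Set.Ioi 1)) (nhds 1) := by
    have := (Complex.continuous_ofReal.tendsto (1 : ℝ)).mono_left
      (nhdsWithin_le_nhds (s := Set.Ioi (1 : ℝ)))
    simpa using this
  have hcast' : Tendsto (fun σ : ℝ => (σ : ℂ)) (nhdsWithin 1 (Set.Ioi 1)) (nhdsWithin 1 {1}ᶜ) := by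
    refine tendsto_nhdsWithin_iff.2 ⟨hcast, ?_⟩
    filter_upwards [self_mem_nhdsWithin] with σ hσ
    have : σ ≠ 1 := ne_of_gt hσ
    simpa using this
  have hz := ((riemannZeta_residue_one.comp hcast').norm).pow 2
  have hsub : Tendsto (fun σ : ℝ => (σ : ℂ) - 1) (nhdsWithin 1 (Set.Ioi 1)) (nhds 0) := by
    simpa using hcast.sub_const 1
  have hL : Tendsto (fun σ : ℝ => ψ.LFunction ((σ : ℂ) - Complex.I * τ))
      (nhdsWithin 1 (Set.Ioi 1)) (nhds (ψ.LFunction (1 - Complex.I * τ))) :=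
    hdiff.continuousAt.tendsto.comp (hcast.sub_const _)
  have hr := (((hsub.mul hL).norm).pow 2).const_mul (Real.exp (8 * C))
  have hle := le_of_tendsto_of_tendsto hz hr (by
    filter_upwards [self_mem_nhdsWithin] with σ hσ
    simp only [Function.comp, norm_mul, mul_pow]
    have := mul_le_mul_of_nonneg_left (norm_zeta_sq_le_of_sum_le hC hσ)
      (sq_nonneg ‖(σ : ℂ) - 1‖)
    linarith)
  norm_num at hle

/-- With `x = Re z`, the left side is at most `2(1 - x²) = 2(1 - εx)(1 + εx)`. This serves as a
triangle inequality, passing from `f` near a twist to the squared twist near `1`. -/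
theorem one_sub_re_sq_le {z : ℂ} (hz : ‖z‖ ≤ 1) {ε : ℝ} (hε : ε = 1 ∨ ε = -1) :
    1 - (z ^ 2).re ≤ 4 * (1 - ε * z.re) := by
  have hz2 : z.re ^ 2 + z.im ^ 2 ≤ 1 := by
    have h : ‖z‖ ^ 2 = z.re ^ 2 + z.im ^ 2 := by rw [Complex.sq_norm, Complex.normSq_apply]; ring
    rw [← h]
    exact pow_le_one₀ (norm_nonneg z) hz
  have h1 : (z ^ 2).re = z.re ^ 2 - z.im ^ 2 := by
    rw [sq, Complex.mul_re]
    ring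
  rw [h1]
  rcases hε with rfl | rfl
  · nlinarith [sq_nonneg (z.re - 1)]
  · nlinarith [sq_nonneg (z.re + 1)]

theorem sq_eq_one_of_pretentiousTo_twist {f : ℕ → ℤ} (hf : IsSignCompletelyMultiplicative f)
    {q : ℕ} (hq : 0 < q) {χ : DirichletCharacter ℂ q} {t : ℝ}
    (h : PretentiousTo (fun n => (f n : ℂ))
      (fun n : ℕ => χ (n : ZMod q) * (n : ℂ) ^ (Complex.I * (t : ℂ)))) :
    χ ^ 2 = 1 ∧ t = 0 := by
  have : NeZero q := ⟨hq.ne'⟩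
  have hnorm : ∀ p : ℕ, p.Prime → ‖χ (p : ZMod q) * (p : ℂ) ^ (Complex.I * (t : ℂ))‖ ≤ 1 := fun p hp => by
    rw [norm_mul, Complex.norm_natCast_cpow_of_pos hp.pos]
    simpa using χ.norm_le_one (p : ZMod q)
  rw [pretentiousTo_iff_bounded fun p hp => hf.re_mul_conj_le_one hp (hnorm p hp)] at h
  obtain ⟨C, hC⟩ := h
  have key : χ ^ 2 = 1 ∧ 2 * t = 0 := by
    refine eq_one_and_eq_zero_of_sum_le (C := 4 * C) fun N => ?_
    refine le_trans ?_ (mul_le_mul_of_nonneg_left (hC N) (by norm_num : (0 : ℝ) ≤ 4))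
    rw [Finset.mul_sum]
    refine le_trans (Finset.sum_le_sum (g := fun p : ℕ => 4 * ((1 - ((f p : ℂ) * (starRingEnd ℂ)
      (χ (p : ZMod q) * (p : ℂ) ^ (Complex.I * (t : ℂ)))).re) / (p : ℝ))) fun p hp => ?_)
      (Finset.sum_le_sum_of_subset_of_nonneg (fun p hp => ?_) fun p hp _ => ?_)
    · have hpp := Nat.prime_of_mem_primesBelow hp
      have hε : ((f p : ℤ) : ℝ) = 1 ∨ ((f p : ℤ) : ℝ) = -1 := by
        exact_mod_cast hf.sign p hpp.pos
      have h1 := one_sub_re_sq_le (hnorm p hpp) hε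
      have h2 : (χ ^ 2) (p : ZMod q) * (p : ℂ) ^ (Complex.I * ((2 * t : ℝ) : ℂ))
          = (χ (p : ZMod q) * (p : ℂ) ^ (Complex.I * (t : ℂ))) ^ 2 := by
        rw [MulChar.pow_apply' χ two_ne_zero, mul_pow, ← Complex.cpow_nat_mul]
        congr 2
        push_cast
        ring
      have h3 : ((f p : ℂ) * (starRingEnd ℂ) (χ (p : ZMod q) * (p : ℂ) ^ (Complex.I * (t : ℂ)))).re
          = (f p : ℝ) * (χ (p : ZMod q) * (p : ℂ) ^ (Complex.I * (t : ℂ))).re := by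
        rw [← Complex.ofReal_intCast, Complex.re_ofReal_mul, Complex.conj_re]
      rw [h2, h3, ← mul_div_assoc]
      exact div_le_div_of_nonneg_right h1 (Nat.cast_nonneg p)
    · obtain ⟨h1, h2⟩ := Nat.mem_primesBelow.1 hp
      exact Finset.mem_filter.2 ⟨Finset.mem_Icc.2 ⟨h2.one_le, h1.le⟩, h2⟩
    · have hpp := (Finset.mem_filter.1 hp).2
      exact mul_nonneg (by norm_num) (div_nonneg (sub_nonneg.2
        (hf.re_mul_conj_le_one hpp (hnorm p hpp))) (Nat.cast_nonneg p))
  exact ⟨key.1, by linarith [key.2]⟩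

/-! ### Normalising the character and conclusion -/

theorem exists_primitive_or_principal {f : ℕ → ℤ} (hf : IsSignCompletelyMultiplicative f)
    {q : ℕ} (hq : 0 < q) {χ : DirichletCharacter ℂ q} (hχ : χ ^ 2 = 1)
    (h : PretentiousTo (fun n => (f n : ℂ)) (fun n => χ (n : ZMod q))) :
    ∃ q' : ℕ, 1 < q' ∧ ∃ χ' : DirichletCharacter ℂ q',
      IsRealCharacter χ' ∧ (χ'.IsPrimitive ∨ χ' = 1) ∧
      PretentiousTo (fun n => (f n : ℂ)) (fun n => χ' (n : ZMod q')) := by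
  have : NeZero q := ⟨hq.ne'⟩
  by_cases hc : χ.conductor = 1
  · have hχ1 : χ = 1 := DirichletCharacter.eq_one_iff_conductor_eq_one.2 hc
    -- The conductor `1` is not an allowed modulus, so the principal character modulo `2` replaces
    -- it, which changes values only at finitely many primes.
    refine ⟨2, one_lt_two, 1, isRealCharacter_of_sq_eq_one (one_pow 2), Or.inr rfl, ?_⟩
    refine h.congr_away hf (fun n _ => χ.norm_le_one _) (fun n _ => DirichletCharacter.norm_le_one _ _)
      (q := 2 * q) (by omega) fun p hp hpq => ?_
    rw [hχ1, MulChar.one_apply (ZMod.isUnit_prime_of_not_dvd hp fun hd => hpq (hd.mul_left 2)),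
      MulChar.one_apply (ZMod.isUnit_prime_of_not_dvd hp fun hd => hpq (hd.mul_right q))]
  · have hc0 : χ.conductor ≠ 0 := DirichletCharacter.conductor_ne_zero χ
    refine ⟨χ.conductor, by omega, χ.primitiveCharacter, isRealCharacter_of_sq_eq_one ?_,
      Or.inl χ.primitiveCharacter_isPrimitive, ?_⟩
    · rw [← DirichletCharacter.changeLevel_eq_one_iff χ.conductor_dvd_level, map_pow,
        DirichletCharacter.changeLevel_primitiveCharacter, hχ]
    · refine h.congr_away hf (fun n _ => χ.norm_le_one _)
        (fun n _ => DirichletCharacter.norm_le_one _ _) hq fun p hp hpq => ?_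
      have := χ.primitiveCharacter_apply_of_isCoprime (a := (p : ℤ))
        (Nat.isCoprime_iff_coprime.2 ((hp.coprime_iff_not_dvd).2 hpq))
      simpa using this.symm

theorem corollary1p4 (k : ℕ) (f : ℕ → ℤ) (hf : IsSignCompletelyMultiplicative f)
    (hk : IsLengthFunction k f) :
    (ElliottConjecture →
      ∃ q : ℕ, 1 < q ∧ ∃ χ : DirichletCharacter ℂ q,
        IsRealCharacter χ ∧ (χ.IsPrimitive ∨ χ = 1) ∧
        PretentiousTo (fun n => (f n : ℂ)) (fun n => χ (n : ZMod q))) ∧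
    (∀ (q : ℕ) (χ : DirichletCharacter ℂ q), 1 < q → IsRealCharacter χ →
      PretentiousTo (fun n => (f n : ℂ)) (fun n => χ (n : ZMod q)) →
        (exceptionalPrimes k f χ).Finite ∧
        ((exceptionalPrimes k f χ).ncard : ℝ) ≤ (k : ℝ) / 2) := by
  refine ⟨fun hE => ?_, fun q χ hq hχ h => ?_⟩
  · by_cases hp : IsPretentious (fun n => (f n : ℂ))
    · obtain ⟨q, hq, χ, t, h⟩ := hp
      obtain ⟨hχ, rfl⟩ := sq_eq_one_of_pretentiousTo_twist hf hq h
      exact exists_primitive_or_principal hf hq hχ (by simpa using h)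
    · exact absurd (exists_run_of_not_isPretentious hE hf hp (k + 1)) hk.not_exists_longer
  · have hcard : ∀ P : Finset ℕ, (P : Set ℕ) ⊆ exceptionalPrimes k f χ → 2 * P.card ≤ k :=
      fun P hP => two_mul_card_exceptional_le hf hk (by omega) hχ h hP
    have hfin : (exceptionalPrimes k f χ).Finite := by
      by_contra hinf
      obtain ⟨P, hP, hPc⟩ := Set.Infinite.exists_subset_card_eq hinf (k + 1)
      have := hcard P hP
      omega
    refine ⟨hfin, ?_⟩
    have h1 := hcard hfin.toFinset (by simp)
    rw [← Set.ncard_eq_toFinset_card _ hfin] at h1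
    have h2 : (2 : ℝ) * (exceptionalPrimes k f χ).ncard ≤ k := by exact_mod_cast h1
    linarith
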